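/- **Setting (no-sensing adversarial multi-player bandits).** There are $K$ arms, $M$ players with $1<M\le K$, and a horizon $T\ge 1$. An oblivious adversary fixes in advance losses $l_k(t)\in[0,1]$ for $k\in[K]$, $t\in[T]$. In slot $t$ player $m$ pulls an arm $\pi_m(t)$ and observes only her received loss $s_m(t)$, which is $1$ if another player pulls the same arm and $l_{\pi_m(t)}(t)$ otherwise. The regret is $$R(T)=\sum_{t=1}^T\sum_{m=1}^M s_m(t)-\min_{k_1,\dots,k_M\in[K]\text{ distinct}}\ \sum_{t=1}^T\sum_{m=1}^M l_{k_m}(t).$$ The local attackability $W(T)$ is the largest length, over all arms $k$, of a run of consecutive slots in $[T]$ with $l_k(t)=1$. **Algorithm ($\alpha$-aware A2C2).** Its parameters are a repetition length $h=h(T)\in\mathbb N$, an exploration length $\tau\in\mathbb{N}$ and a learning rate $\eta\ge 0$. Time is divided into phases $p=1,2,\dots$ (cut off at the horizon $T$); each consists of a communication phase of $(M-1)\lceil\log_2K\rceil h$ slots followed by an exploration phase of $\tau$ slots. At the start of phase $p$ player $1$ (the leader) draws a set $A$ of $M$ distinct arms with probability $$P_A(p)=\frac{e^{-\eta\tilde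 L_A(p)}}{\sum_{J\subseteq[K],|J|=M}e^{-\eta\tilde L_J(p)}},\qquad \tilde L_A(p)=\sum_{v<p}\sum_{k\in A}\tilde l_k(v),$$ and orders it by a uniformly random permutation into $(\tilde A_1,\dots,\tilde A_M)$. In the communication phase every follower $m=2,\dots,M$ stays on arm $m$; the leader addresses the followers one after the other and sends the $\lceil\log_2K\rceil$ binary digits of $\tilde A_m-1$, each repeated for $h$ slots, by pulling arm $m$ for a digit $1$ and arm $1$ for a digit $0$. A follower reads a digit as $1$ iff all $h$ losses she receives in its block equal $1$, and as $0$ otherwise. In the exploration phase the leader stays on $\tilde A_1$ and each follower on the arm she decoded (on arm $m$ if the decoded number is not the index of an arm); the leader records her cumulative loss $\hat l(p)$ of the exploration phase and sets $$\tilde l_k(p)=\frac{M}{\tau}\,\frac{\hat l(p)}{\sum_{A\ni k}P_A(p)}\,\mathbf 1\{\tilde A_1=k\},\qquad k\in[K].$$ **Theorem.** Let $\alpha\in[0,1]$, $\epsilon>0$, $w\in\mathbb R$, and let $h:\mathbb N\to\mathbb N$ satisfy $h(T)=\Theta(T^{\alpha+\epsilon})$ as $T\to\infty$. There is a constant $C>0$,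 depending only on $\alpha,\epsilon,w$ and $h$, such that for all $1<M\le K$, all $T\ge1$ and all losses $l_k(t)\in[0,1]$ with $W(T)\le wT^{\alpha}$, the algorithm run with repetition length $h(T)$, $$\tau=\Big\lceil M^{\frac23}K^{-\frac13}\log(K)^{\frac13}T^{\frac{1+2\alpha+2\epsilon}3}\Big\rceil,\qquad \eta=\sqrt{\frac{\log\binom KM\,\tau}{MKT}},$$ satisfies $$\mathbb E[R(T)]\le C\,M^{\frac43}K^{\frac13}\log(K)^{\frac23}T^{\frac{2+\alpha+\epsilon}3},$$ where the expectation is over the algorithm's randomization. -/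

import Mathlib

open scoped BigOperators

namespace A2C2

/-! ### The no-sensing adversarial multi-player bandit game

Arms are `Fin K`, players are `Fin M`, time slots are `t = 0, …, T - 1`; `l t k` is the loss that the
(oblivious) adversary assigned to arm `k` in slot `t`. -/

/-- The collision indicator of arm `k` under the joint action `π`: `1` if more than one player
pulls `k`. -/
def collision {M K : ℕ} (π : Fin M → Fin K) (k : Fin K) : ℝ :=
  if 1 < (Finset.univ.filter fun n => π n = k).card then 1 else 0

/-- The loss received by player `m` in a slot with losses `v` and joint action `π`. -/
def received {M K : ℕ} (v : Fin K → ℝ) (π : Fin M → Fin K) (m : Fin M) : ℝ :=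
  v (π m) * (1 - collision π (π m)) + collision π (π m)

/-- The maximal length of a run of consecutive losses `1` on arm `k` within the first `T` slots. -/
noncomputable def longestRun {K : ℕ} (l : ℕ → Fin K → ℝ) (T : ℕ) (k : Fin K) : ℕ :=
  sSup {n : ℕ | ∃ s : ℕ, s + n ≤ T ∧ ∀ i < n, l (s + i) k = 1}

/-- The local attackability `W(T)`: the longest all-one run on any arm. -/
noncomputable def localAttackability {K : ℕ} (l : ℕ → Fin K → ℝ) (T : ℕ) : ℕ :=
  Finset.univ.sup (longestRun l T)

/-! ### The algorithm -/

/-- The data of an instance of the algorithm: `h` is the length of the repetition code, `τ` the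
length of an exploration phase, `η` the learning rate. -/
structure Config (M K : ℕ) where
  one_lt : 1 < M
  le : M ≤ K
  h : ℕ
  τ : ℕ
  η : ℝ

variable {M K : ℕ}

namespace Config

/-- Player `0` is the leader. -/
def leader (c : Config M K) : Fin M := ⟨0, Nat.zero_lt_of_lt c.one_lt⟩

/-- The communication arm of player `m` is arm `m`. -/
def commArm (c : Config M K) (m : Fin M) : Fin K := Fin.castLE c.le m

/-- The number `⌈log₂ K⌉` of bits of an arm index. -/
def bits (_c : Config M K) : ℕ := Nat.clog 2 K

/-- The length of a communication phase: `M - 1` followers, `bits` bits each, every bit repeated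
`h` times. -/
def commLen (c : Config M K) : ℕ := (M - 1) * c.bits * c.h

/-- The length of a communication phase together with the exploration phase following it; slot `t`
belongs to phase `t / phaseLen`. -/
def phaseLen (c : Config M K) : ℕ := c.commLen + c.τ

/-- The leader's arm in slot `t`, given the arm assignments `a 0, a 1, …` that she has drawn. In a
communication phase the followers `1, …, M - 1` are served in turn; within the share of
follower `r` the binary digits of `a p r` are sent one after the other, each for `h` slots:
for a digit `1` the leader pulls the communication arm of `r` (forced collision), for a digit `0`
her own one. In the exploration phase she stays on her own assigned arm. -/
def leaderArm (c : Config M K) (a : ℕ → Fin M → Fin K) (t : ℕ) : Fin K :=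
  let p := t / c.phaseLen
  let o := t % c.phaseLen
  if o < c.commLen then
    let j := o / c.h
    if hr : j / c.bits + 1 < M then
      if (a p ⟨j / c.bits + 1, hr⟩ : ℕ).testBit (j % c.bits) then
        c.commArm ⟨j / c.bits + 1, hr⟩
      else c.commArm c.leader
    else c.commArm c.leader
  else a p c.leader

open Classical in
/-- The arm index that follower `m` decodes in phase `p` from the losses `y` she has observed in the
slots before `t`: digit `b` is read as `1` iff all `h` losses in its block equal `1`. -/
noncomputable def decode (c : Config M K) (m : Fin M) (p t : ℕ) (y : Fin t → ℝ) : ℕ :=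
  ∑ b ∈ Finset.range c.bits,
    let start := p * c.phaseLen + (((m : ℕ) - 1) * c.bits + b) * c.h
    if ∀ s : Fin t, start ≤ s → (s : ℕ) < start + c.h → y s = 1 then 2 ^ b else 0

/-- The arm of follower `m` in slot `t`, given the losses `y` she has observed before: her
communication arm during communication, the decoded arm during exploration (if the decoded index
is not an arm, she stays on her communication arm). -/
noncomputable def followerArm (c : Config M K) (m : Fin M) (t : ℕ) (y : Fin t → ℝ) : Fin K :=
  if t % c.phaseLen < c.commLen then c.commArm m
  else if hk : c.decode m (t / c.phaseLen) t y < K then ⟨_, hk⟩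
  else c.commArm m

/-- The arm of player `m` in slot `t`, given the leader's draws `a` and the losses `y` that player
`m` has observed before. -/
noncomputable def arm (c : Config M K) (a : ℕ → Fin M → Fin K) (m : Fin M) (t : ℕ)
    (y : Fin t → ℝ) : Fin K :=
  if m = c.leader then c.leaderArm a t else c.followerArm m t y

/-- The loss received by each player in slot `t` against the losses `l`, when the leader's draws
are `a`. -/
noncomputable def obs (c : Config M K) (l : ℕ → Fin K → ℝ) (a : ℕ → Fin M → Fin K) (t : ℕ) :
    Fin M → ℝ :=
  received (l t) fun n => c.arm a n t fun s : Fin t => obs c l a s n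
termination_by t
decreasing_by exact s.2

end Config

/-- A meta-arm: a set of `M` distinct arms. -/
abbrev MetaArm (M K : ℕ) := {A : Finset (Fin K) // A.card = M}

/-- The exponential-weights probability of the meta-arm `A`, where `L k` is the cumulative loss
estimate of arm `k`, so that the cumulative estimate of `A` is `∑ k ∈ A, L k`. -/
noncomputable def metaProb (η : ℝ) (L : Fin K → ℝ) (A : MetaArm M K) : ℝ :=
  Real.exp (-η * ∑ k ∈ A.1, L k) / ∑ J : MetaArm M K, Real.exp (-η * ∑ k ∈ J.1, L k)

theorem metaProb_nonneg (η : ℝ) (L : Fin K → ℝ) (A : MetaArm M K) : 0 ≤ metaProb η L A :=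
  div_nonneg (Real.exp_pos _).le (Finset.sum_nonneg fun _ _ => (Real.exp_pos _).le)

theorem sum_metaProb (hMK : M ≤ K) (η : ℝ) (L : Fin K → ℝ) :
    ∑ A : MetaArm M K, metaProb η L A = 1 := by
  obtain ⟨A, _, hA⟩ := Finset.exists_subset_card_eq
    (s := (Finset.univ : Finset (Fin K))) (n := M) (by simpa using hMK)
  have hpos : 0 < ∑ J : MetaArm M K, Real.exp (-η * ∑ k ∈ J.1, L k) :=
    Finset.sum_pos (fun _ _ => Real.exp_pos _) ⟨⟨A, hA⟩, Finset.mem_univ _⟩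
  unfold metaProb
  rw [← Finset.sum_div, div_self hpos.ne']

namespace Config

/-- The probability distribution `metaProb` on meta-arms. -/
noncomputable def metaLaw (c : Config M K) (L : Fin K → ℝ) : PMF (MetaArm M K) :=
  PMF.ofFintype (fun A => ENNReal.ofReal (metaProb c.η L A)) (by
    rw [← ENNReal.ofReal_sum_of_nonneg fun A _ => metaProb_nonneg c.η L A,
      sum_metaProb c.le, ENNReal.ofReal_one])

/-- The arm assignment of one phase: a meta-arm is drawn from `metaLaw`, then permuted uniformly
at random; player `m` is assigned the `m`-th arm of the result. -/
noncomputable def assignLaw (c : Config M K) (L : Fin K → ℝ) : PMF (Fin M → Fin K) :=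
  (c.metaLaw L).bind fun A =>
    (PMF.uniformOfFintype (Equiv.Perm (Fin M))).map fun σ m => A.1.orderEmbOfFin A.2 (σ m)

/-- The cumulative loss the leader records in the exploration phase of phase `p`, where `x t` is the
loss she observed in slot `t`. -/
def phaseLoss (c : Config M K) (x : ℕ → ℝ) (p : ℕ) : ℝ :=
  ∑ i ∈ Finset.range c.τ, x (p * c.phaseLen + c.commLen + i)

/-- The leader's estimator of the (averaged) loss of arm `k` in a phase in which she was assigned
the arm `j` and recorded the cumulative loss `z`, when `L` are the cumulative estimates before
that phase. -/
noncomputable def estimate (c : Config M K) (L : Fin K → ℝ) (j : Fin K) (z : ℝ) (k : Fin K) : ℝ :=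
  if j = k then
    (M : ℝ) / (c.τ : ℝ) *
      (z / ∑ A ∈ (Finset.univ : Finset (MetaArm M K)).filter (fun A => k ∈ A.1), metaProb c.η L A)
  else 0

/-- The cumulative loss estimates at the beginning of phase `p`, a function of the leader's draws
`a` and observed losses `x` in the phases before `p`. -/
noncomputable def cumEstimate (c : Config M K) (a : ℕ → Fin M → Fin K) (x : ℕ → ℝ) :
    ℕ → Fin K → ℝ
  | 0 => fun _ => 0
  | p + 1 => fun k => cumEstimate c a x p k +
      c.estimate (cumEstimate c a x p) (a p c.leader) (c.phaseLoss x p) k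

/-- Extend the draws of the phases before `p` to a sequence; the values from `p` on have no
influence on anything that happens before phase `p`. -/
def extend (c : Config M K) {p : ℕ} (a : Fin p → Fin M → Fin K) (q : ℕ) : Fin M → Fin K :=
  if hq : q < p then a ⟨q, hq⟩ else c.commArm

/-- The joint law of the leader's draws in the first `p` phases. -/
noncomputable def law (c : Config M K) (l : ℕ → Fin K → ℝ) :
    (p : ℕ) → PMF (Fin p → Fin M → Fin K)
  | 0 => PMF.pure fun i => i.elim0
  | p + 1 => (law c l p).bind fun a =>
      (c.assignLaw
        (c.cumEstimate (c.extend a) (fun t => c.obs l (c.extend a) t c.leader) p)).map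
        fun b => Fin.snoc (α := fun _ => Fin M → Fin K) a b

/-- The regret after `T` slots against the best fixed assignment of distinct arms. -/
noncomputable def regret (c : Config M K) (l : ℕ → Fin K → ℝ) (T : ℕ)
    (a : ℕ → Fin M → Fin K) : ℝ :=
  ∑ t ∈ Finset.range T, ∑ m, c.obs l a t m -
    ⨅ k : Fin M ↪ Fin K, ∑ t ∈ Finset.range T, ∑ m, l t (k m)

/-- The expected regret after `T` slots; the expectation is over the leader's draws in the phases
`0, …, T / phaseLen`, which cover all the slots before `T`. -/
noncomputable def expectedRegret (c : Config M K) (l : ℕ → Fin K → ℝ) (T : ℕ) : ℝ :=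
  ∑ a : Fin (T / c.phaseLen + 1) → Fin M → Fin K,
    (c.law l (T / c.phaseLen + 1) a).toReal * c.regret l T (c.extend a)

end Config

end A2C2

/-! The code is reliable because a block of `h` slots longer than the local attackability contains,
on every arm, a loss different from `1`. A digit 0 is therefore never read as 1, while a digit 1 is
always read correctly because the collisions are forced. Since `h` has order `T ^ (α + ε)`, it
exceeds `w * T ^ α` for all large `T`. From then on decoding is exact, and in exploration the
players sit without collision on the drawn arms (`decode_eq`, `obs_exploration`).

What remains is exponential weights over `M`-subsets, with one round per phase. The random
permutation gives the leader arm `k` with probability `armProb / M`, so her loss alone yields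
unbiased estimates (`pmfMean_histEstimate`). Each estimate is supported on a single arm. In the
potential argument (`potential_add_single_le`, `pmfMean_potential_le`) the second-order cost of a
phase is therefore at most `η² M K / 2` on average. Comparing with a fixed assignment gives
`pmfMean_playersLoss_le`.

All other slots, namely communication and the last incomplete phase, cost at most `M` each
(`sum_obs_sub_le`). The prescribed `η` balances the two exploration terms
(`expectedRegret_le_sqrt`). The prescribed `τ` balances exploration against communication, which two
identities between the rate and the exploration length express (`expectedRegret_le_rate`). Small
horizons, and exploration lengths that round up from below 1, fall under the trivial bound `M * T`.
-/

namespace A2C2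

variable {M K : ℕ}

/-! ### Expectations on finite probability spaces. -/

/-- The mean of a real function under a probability mass function on a finite type. -/
noncomputable def pmfMean {Ω : Type*} [Fintype Ω] (p : PMF Ω) (f : Ω → ℝ) : ℝ :=
  ∑ x, (p x).toReal * f x

section pmfMean

variable {Ω Ω' : Type*} [Fintype Ω] [Fintype Ω']

theorem pmfMean_bind (p : PMF Ω) (q : Ω → PMF Ω') (f : Ω' → ℝ) :
    pmfMean (p.bind q) f = pmfMean p fun x => pmfMean (q x) f := by
  unfold pmfMean
  have h : ∀ y, ((p.bind q) y).toReal = ∑ x, (p x).toReal * (q x y).toReal := by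
    intro y
    rw [PMF.bind_apply, tsum_fintype, ENNReal.toReal_sum]
    · simp [ENNReal.toReal_mul]
    · exact fun x _ => ENNReal.mul_ne_top (p.apply_ne_top x) ((q x).apply_ne_top y)
  simp_rw [h, Finset.sum_mul, Finset.mul_sum]
  rw [Finset.sum_comm]
  simp only [mul_assoc]

theorem pmfMean_pure (x : Ω) (f : Ω → ℝ) : pmfMean (PMF.pure x) f = f x := by
  classical
  unfold pmfMean
  rw [Finset.sum_eq_single x] <;> simp +contextual

theorem pmfMean_map (p : PMF Ω) (g : Ω → Ω') (f : Ω' → ℝ) :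
    pmfMean (p.map g) f = pmfMean p fun x => f (g x) := by
  rw [PMF.map, pmfMean_bind]
  simp only [Function.comp, pmfMean_pure]

theorem pmfMean_mono (p : PMF Ω) {f g : Ω → ℝ} (h : ∀ x, p x ≠ 0 → f x ≤ g x) :
    pmfMean p f ≤ pmfMean p g := by
  refine Finset.sum_le_sum fun x _ => ?_
  by_cases hx : p x = 0
  · simp [hx]
  · exact mul_le_mul_of_nonneg_left (h x hx) ENNReal.toReal_nonneg

theorem pmfMean_congr (p : PMF Ω) {f g : Ω → ℝ} (h : ∀ x, p x ≠ 0 → f x = g x) :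
    pmfMean p f = pmfMean p g :=
  le_antisymm (pmfMean_mono p fun x hx => (h x hx).le) (pmfMean_mono p fun x hx => (h x hx).ge)

theorem pmfMean_const (p : PMF Ω) (r : ℝ) : pmfMean p (fun _ => r) = r := by
  have h : ∑ x, (p x).toReal = 1 := by
    rw [← ENNReal.toReal_sum fun x _ => p.apply_ne_top x, ← tsum_fintype (L := .unconditional _),
      p.tsum_coe, ENNReal.toReal_one]
  rw [pmfMean, ← Finset.sum_mul, h, one_mul]

theorem pmfMean_add (p : PMF Ω) (f g : Ω → ℝ) :
    pmfMean p (fun x => f x + g x) = pmfMean p f + pmfMean p g := by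
  simp [pmfMean, mul_add, Finset.sum_add_distrib]

theorem pmfMean_const_mul (p : PMF Ω) (r : ℝ) (f : Ω → ℝ) :
    pmfMean p (fun x => r * f x) = r * pmfMean p f := by
  simp only [pmfMean, Finset.mul_sum]
  exact Finset.sum_congr rfl fun _ _ => by ring

theorem pmfMean_sum {ι : Type*} (p : PMF Ω) (s : Finset ι) (f : ι → Ω → ℝ) :
    pmfMean p (fun x => ∑ i ∈ s, f i x) = ∑ i ∈ s, pmfMean p (f i) := by
  simp only [pmfMean, Finset.mul_sum]
  exact Finset.sum_comm

end pmfMean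

/-! ### Marginals of the drawn assignment. -/

/-- A uniformly random permutation takes a given point to a uniformly random one. -/
theorem pmfMean_uniform_perm_apply (f : Fin M → ℝ) (i : Fin M) :
    pmfMean (PMF.uniformOfFintype (Equiv.Perm (Fin M))) (fun σ => f (σ i)) =
      (M : ℝ)⁻¹ * ∑ j, f j := by
  set N : ℝ := ∑ σ : Equiv.Perm (Fin M), f (σ i) with hN
  have hM : (M : ℝ) ≠ 0 := by
    have := i.pos
    positivity
  -- Composing with a transposition shows that the sum does not depend on the point. Summing over
  -- all points then counts the same double sum in two ways.
  have hi : ∀ j, ∑ σ : Equiv.Perm (Fin M), f (σ j) = N := by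
    intro j
    rw [hN]
    refine Fintype.sum_equiv (Equiv.mulRight (Equiv.swap i j)) _ _ fun σ => ?_
    simp
  have h1 : (M : ℝ) * N = (Fintype.card (Equiv.Perm (Fin M)) : ℝ) * ∑ j, f j := by
    calc (M : ℝ) * N = ∑ j : Fin M, ∑ σ : Equiv.Perm (Fin M), f (σ j) := by
          simp [hi]
      _ = ∑ σ : Equiv.Perm (Fin M), ∑ j, f (σ j) := Finset.sum_comm
      _ = ∑ σ : Equiv.Perm (Fin M), ∑ j, f j :=
          Finset.sum_congr rfl fun σ _ => Equiv.sum_comp σ f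
      _ = _ := by simp
  have hc : (Fintype.card (Equiv.Perm (Fin M)) : ℝ) ≠ 0 := by
    exact_mod_cast Fintype.card_ne_zero
  have h2 : pmfMean (PMF.uniformOfFintype (Equiv.Perm (Fin M))) (fun σ => f (σ i)) =
      (Fintype.card (Equiv.Perm (Fin M)) : ℝ)⁻¹ * N := by
    simp only [pmfMean, PMF.uniformOfFintype_apply, ENNReal.toReal_inv, ENNReal.toReal_natCast,
      ← Finset.mul_sum, hN]
  rw [h2]
  field_simp
  linarith

/-- The probability that arm `k` belongs to the meta-arm drawn by exponential weights. -/
noncomputable def armProb (M : ℕ) (η : ℝ) (L : Fin K → ℝ) (k : Fin K) : ℝ :=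
  ∑ A ∈ (Finset.univ : Finset (MetaArm M K)).filter (fun A => k ∈ A.1), metaProb η L A

/-- Exchange of summation: a loss additive over the arms of a meta-arm has a mean that sees only the
inclusion probabilities. -/
theorem sum_metaProb_mul_sum (η : ℝ) (L F : Fin K → ℝ) :
    ∑ A : MetaArm M K, metaProb η L A * ∑ k ∈ A.1, F k = ∑ k, armProb M η L k * F k := by
  simp only [armProb, Finset.sum_mul, Finset.mul_sum, Finset.sum_filter, ite_mul, zero_mul]
  rw [Finset.sum_comm]
  refine Finset.sum_congr rfl fun A _ => ?_
  rw [← Finset.sum_filter]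
  refine Finset.sum_congr ?_ fun _ _ => rfl
  ext
  simp

theorem metaWeight_pos (hMK : M ≤ K) (η : ℝ) (L : Fin K → ℝ) :
    0 < ∑ J : MetaArm M K, Real.exp (-η * ∑ k ∈ J.1, L k) := by
  obtain ⟨A, _, hA⟩ := Finset.exists_subset_card_eq
    (s := (Finset.univ : Finset (Fin K))) (n := M) (by simpa using hMK)
  exact Finset.sum_pos (fun _ _ => Real.exp_pos _) ⟨⟨A, hA⟩, Finset.mem_univ _⟩

theorem armProb_pos (hM : 0 < M) (hMK : M ≤ K) (η : ℝ) (L : Fin K → ℝ) (k : Fin K) :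
    0 < armProb M η L k := by
  obtain ⟨A, hkA, _, hA⟩ := Finset.exists_subsuperset_card_eq
    (s := ({k} : Finset (Fin K))) (t := Finset.univ) (n := M) (Finset.subset_univ _)
    (by rw [Finset.card_singleton]; exact hM) (by simpa using hMK)
  refine Finset.sum_pos (fun J _ => div_pos (Real.exp_pos _) (metaWeight_pos hMK η L))
    ⟨⟨A, hA⟩, ?_⟩
  simpa using hkA

namespace Config

theorem pmfMean_metaLaw (c : Config M K) (L : Fin K → ℝ) (f : MetaArm M K → ℝ) :
    pmfMean (c.metaLaw L) f = ∑ A, metaProb c.η L A * f A := by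
  refine Finset.sum_congr rfl fun A _ => ?_
  rw [metaLaw, PMF.ofFintype_apply, ENNReal.toReal_ofReal (metaProb_nonneg _ _ _)]

/-- The arm of any given player is distributed according to `armProb / M`. -/
theorem pmfMean_assignLaw_apply (c : Config M K) (L F : Fin K → ℝ) (m : Fin M) :
    pmfMean (c.assignLaw L) (fun b => F (b m)) =
      (M : ℝ)⁻¹ * ∑ k, armProb M c.η L k * F k := by
  rw [assignLaw, pmfMean_bind, ← sum_metaProb_mul_sum, Finset.mul_sum, pmfMean_metaLaw]
  refine Finset.sum_congr rfl fun A _ => ?_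
  rw [pmfMean_map,
    pmfMean_uniform_perm_apply (fun i => F (A.1.orderEmbOfFin A.2 i)) m]
  have h : ∑ j, F (A.1.orderEmbOfFin A.2 j) = ∑ k ∈ A.1, F k := by
    conv_rhs => rw [← Finset.map_orderEmbOfFin_univ A.1 A.2, Finset.sum_map]
    rfl
  rw [h]
  ring

theorem pmfMean_assignLaw_sum (c : Config M K) (L F : Fin K → ℝ) :
    pmfMean (c.assignLaw L) (fun b => ∑ m, F (b m)) = ∑ k, armProb M c.η L k * F k := by
  have hM : (M : ℝ) ≠ 0 := by
    have := c.one_lt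
    positivity
  rw [pmfMean_sum]
  simp only [pmfMean_assignLaw_apply, Finset.sum_const, Finset.card_univ, Fintype.card_fin,
    nsmul_eq_mul]
  rw [← mul_assoc, mul_inv_cancel₀ hM, one_mul]

theorem injective_of_assignLaw_ne_zero (c : Config M K) (L : Fin K → ℝ) {b : Fin M → Fin K}
    (hb : c.assignLaw L b ≠ 0) : Function.Injective b := by
  rw [← PMF.mem_support_iff, assignLaw, PMF.mem_support_bind_iff] at hb
  obtain ⟨A, _, hb⟩ := hb
  rw [PMF.mem_support_map_iff] at hb
  obtain ⟨σ, _, rfl⟩ := hb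
  exact (A.1.orderEmbOfFin A.2).injective.comp σ.injective

end Config

/-! ### The exponential-weights potential. -/

/-- Multiply `1 + x + x²/2 ≤ exp x` by `1 - x + x²/2`: the left side becomes `1 + x⁴/4 ≥ 1`. -/
theorem exp_neg_le_one_sub_add {x : ℝ} (hx : 0 ≤ x) :
    Real.exp (-x) ≤ 1 - x + x ^ 2 / 2 := by
  have h := Real.quadratic_le_exp_of_nonneg hx
  have h1 : 0 ≤ 1 - x + x ^ 2 / 2 := by nlinarith [sq_nonneg (x - 1)]
  rw [Real.exp_neg, inv_le_iff_one_le_mul₀ (Real.exp_pos x)]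
  nlinarith [sq_nonneg (x ^ 2), mul_le_mul_of_nonneg_left h h1]

/-- The logarithm of the total exponential weight. -/
noncomputable def potential (M : ℕ) (η : ℝ) (L : Fin K → ℝ) : ℝ :=
  Real.log (∑ J : MetaArm M K, Real.exp (-η * ∑ k ∈ J.1, L k))

/-- Keeping a single summand of the total weight is how the comparator enters the regret bound. -/
theorem neg_mul_sum_le_potential (η : ℝ) (L : Fin K → ℝ) (A : MetaArm M K) :
    -η * ∑ k ∈ A.1, L k ≤ potential M η L := by
  rw [potential, ← Real.log_exp (-η * ∑ k ∈ A.1, L k)]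
  exact Real.log_le_log (Real.exp_pos _)
    (Finset.single_le_sum (f := fun J : MetaArm M K => Real.exp (-η * ∑ k ∈ J.1, L k))
      (fun _ _ => (Real.exp_pos _).le) (Finset.mem_univ A))

theorem potential_zero (η : ℝ) : potential M η (fun _ : Fin K => 0) = Real.log (K.choose M) := by
  simp [potential]

/-- The effect on the potential of an estimate `e ≥ 0` supported on a single arm `j`. -/
theorem potential_add_single_le (hMK : M ≤ K) {η : ℝ} (hη : 0 ≤ η) (L : Fin K → ℝ) (j : Fin K)
    {e : ℝ} (he : 0 ≤ e) :
    potential M η (fun k => L k + if j = k then e else 0) ≤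
      potential M η L - η * (armProb M η L j * e) + η ^ 2 / 2 * (armProb M η L j * e ^ 2) := by
  have hpos := metaWeight_pos hMK η L
  have hsum : ∀ A : MetaArm M K, ∑ k ∈ A.1, (L k + if j = k then e else 0) =
      ∑ k ∈ A.1, L k + if j ∈ A.1 then e else 0 := by
    intro A
    rw [Finset.sum_add_distrib, Finset.sum_ite_eq]
  have hle : ∀ A : MetaArm M K,
      Real.exp (-η * ∑ k ∈ A.1, (L k + if j = k then e else 0)) ≤
        Real.exp (-η * ∑ k ∈ A.1, L k) *
          (1 + if j ∈ A.1 then (-η * e + η ^ 2 / 2 * e ^ 2) else 0) := by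
    intro A
    rw [hsum, mul_add, Real.exp_add]
    refine mul_le_mul_of_nonneg_left ?_ (Real.exp_pos _).le
    split_ifs
    · have := exp_neg_le_one_sub_add (mul_nonneg hη he)
      rw [neg_mul]
      linarith [this, mul_pow η e 2]
    · simp
  have hratio : ∑ A : MetaArm M K, Real.exp (-η * ∑ k ∈ A.1, L k) *
          (1 + if j ∈ A.1 then (-η * e + η ^ 2 / 2 * e ^ 2) else 0) =
      (∑ A : MetaArm M K, Real.exp (-η * ∑ k ∈ A.1, L k)) *
        (1 + armProb M η L j * (-η * e + η ^ 2 / 2 * e ^ 2)) := by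
    have : armProb M η L j = (∑ A : MetaArm M K, if j ∈ A.1 then
        Real.exp (-η * ∑ k ∈ A.1, L k) else 0) /
        ∑ A : MetaArm M K, Real.exp (-η * ∑ k ∈ A.1, L k) := by
      rw [armProb, Finset.sum_filter, Finset.sum_div]
      refine Finset.sum_congr rfl fun A _ => ?_
      split_ifs <;> simp [metaProb]
    rw [this, mul_add, mul_one, ← mul_assoc, mul_div_cancel₀ _ hpos.ne', Finset.sum_mul,
      ← Finset.sum_add_distrib]
    refine Finset.sum_congr rfl fun A _ => ?_
    split_ifs <;> ring
  have hnew := metaWeight_pos hMK η (fun k => L k + if j = k then e else 0)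
  have hle' := (Finset.sum_le_sum fun A (_ : A ∈ Finset.univ) => hle A).trans_eq hratio
  -- Positivity is inherited from the new total weight, which this factor times the old weight
  -- dominates. No smallness of `η * e` is needed.
  have hfac : 0 < 1 + armProb M η L j * (-η * e + η ^ 2 / 2 * e ^ 2) :=
    (mul_pos_iff_of_pos_left hpos).1 (hnew.trans_le hle')
  have hlog := Real.log_le_log hnew hle'
  rw [Real.log_mul hpos.ne' hfac.ne'] at hlog
  have := Real.log_le_sub_one_of_pos hfac
  unfold potential
  linarith

/-! ### Binary digits, collisions and runs of ones. -/

theorem sum_range_testBit (x n : ℕ) :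
    ∑ b ∈ Finset.range n, (if x.testBit b then 2 ^ b else 0) = x % 2 ^ n := by
  induction n with
  | zero => simp [Nat.mod_one]
  | succ n ih =>
    rw [Finset.sum_range_succ, ih, Nat.mod_pow_succ, Nat.testBit_eq_decide_div_mod_eq]
    rcases Nat.mod_two_eq_zero_or_one (x / 2 ^ n) with h | h <;> simp [h]

theorem collision_of_injective {π : Fin M → Fin K} (hπ : Function.Injective π) (k : Fin K) :
    collision π k = 0 := by
  rw [collision, if_neg]
  rw [not_lt, Finset.card_le_one]
  intro a ha b hb
  simp only [Finset.mem_filter, Finset.mem_univ, true_and] at ha hb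
  exact hπ (ha.trans hb.symm)

theorem received_of_injective {π : Fin M → Fin K} (hπ : Function.Injective π) (v : Fin K → ℝ)
    (m : Fin M) : received v π m = v (π m) := by
  simp [received, collision_of_injective hπ]

theorem received_of_collision {π : Fin M → Fin K} {m n : Fin M} (hmn : m ≠ n) (h : π m = π n)
    (v : Fin K → ℝ) : received v π m = 1 := by
  have : collision π (π m) = 1 := by
    rw [collision, if_pos]
    rw [Finset.one_lt_card]
    exact ⟨m, by simp, n, by simp [h], hmn⟩
  simp [received, this]

theorem received_mem_Icc {v : Fin K → ℝ} (hv : ∀ k, v k ∈ Set.Icc (0 : ℝ) 1) (π : Fin M → Fin K)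
    (m : Fin M) : received v π m ∈ Set.Icc (0 : ℝ) 1 := by
  rw [received, collision]
  split_ifs
  · simp
  · simpa using hv (π m)

/-- This is the only way attackability enters: it makes a transmitted 0 recognizable. The run
lengths are bounded by `T`, so their supremum is a genuine one. -/
theorem exists_ne_one_of_localAttackability_lt {l : ℕ → Fin K → ℝ} {T n : ℕ}
    (hn : localAttackability l T < n) (k : Fin K) {s : ℕ} (hs : s + n ≤ T) :
    ∃ i < n, l (s + i) k ≠ 1 := by
  by_contra! hall
  have h1 : n ≤ longestRun l T k := by
    refine le_csSup ⟨T, ?_⟩ ⟨s, hs, hall⟩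
    rintro n ⟨s, hs, _⟩
    omega
  have h2 : longestRun l T k ≤ localAttackability l T :=
    Finset.le_sup (f := longestRun l T) (Finset.mem_univ k)
  omega

/-! ### Correctness of the communication. -/

namespace Config

variable (c : Config M K) (l : ℕ → Fin K → ℝ) (a : ℕ → Fin M → Fin K)

theorem obs_eq (t : ℕ) :
    c.obs l a t = received (l t) fun n => c.arm a n t fun s : Fin t => c.obs l a s n := by
  rw [obs]

theorem obs_mem_Icc {t : ℕ} (hl : ∀ k, l t k ∈ Set.Icc (0 : ℝ) 1) (m : Fin M) :
    c.obs l a t m ∈ Set.Icc (0 : ℝ) 1 := by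
  rw [obs_eq]
  exact received_mem_Icc hl _ m

theorem commArm_injective : Function.Injective c.commArm := Fin.castLE_injective c.le

theorem arm_of_ne_leader_of_comm {m : Fin M} (hm : m ≠ c.leader) {t : ℕ}
    (ht : t % c.phaseLen < c.commLen) (y : Fin t → ℝ) : c.arm a m t y = c.commArm m := by
  rw [arm, if_neg hm, followerArm, if_pos ht]

theorem one_le_of_ne_leader {m : Fin M} (hm : m ≠ c.leader) : 1 ≤ (m : ℕ) := by
  rw [Nat.one_le_iff_ne_zero]
  intro h
  exact hm (Fin.ext h)

/-- The offset of a slot of the block in which digit `b` is sent to follower `m`. -/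
theorem block_offset_lt {m : Fin M} (hm : m ≠ c.leader) {b i : ℕ} (hb : b < c.bits)
    (hi : i < c.h) : (((m : ℕ) - 1) * c.bits + b) * c.h + i < c.commLen := by
  have h1 := c.one_le_of_ne_leader hm
  have h2 := m.2
  have h3 : (((m : ℕ) - 1) * c.bits + b) + 1 ≤ (M - 1) * c.bits := by
    calc _ ≤ ((m : ℕ) - 1) * c.bits + c.bits := by omega
      _ = ((m : ℕ) - 1 + 1) * c.bits := by ring
      _ ≤ _ := Nat.mul_le_mul_right _ (by omega)
  calc _ < (((m : ℕ) - 1) * c.bits + b) * c.h + c.h := by omega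
    _ = ((((m : ℕ) - 1) * c.bits + b) + 1) * c.h := by ring
    _ ≤ _ := Nat.mul_le_mul_right _ h3

theorem leaderArm_block {m : Fin M} (hm : m ≠ c.leader) {p b i : ℕ} (hb : b < c.bits)
    (hi : i < c.h) :
    c.leaderArm a (p * c.phaseLen + (((m : ℕ) - 1) * c.bits + b) * c.h + i) =
      if (a p m : ℕ).testBit b then c.commArm m else c.commArm c.leader := by
  have ho := c.block_offset_lt hm hb hi
  have ho' : (((m : ℕ) - 1) * c.bits + b) * c.h + i < c.phaseLen := Nat.lt_add_right _ ho
  have h1 := c.one_le_of_ne_leader hm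
  rw [add_assoc]
  have hdiv : (p * c.phaseLen + ((((m : ℕ) - 1) * c.bits + b) * c.h + i)) / c.phaseLen = p := by
    rw [mul_comm, Nat.mul_add_div (by omega), Nat.div_eq_of_lt ho', add_zero]
  have hmod : (p * c.phaseLen + ((((m : ℕ) - 1) * c.bits + b) * c.h + i)) % c.phaseLen =
      (((m : ℕ) - 1) * c.bits + b) * c.h + i := by
    rw [mul_comm, Nat.mul_add_mod, Nat.mod_eq_of_lt ho']
  have hj : ((((m : ℕ) - 1) * c.bits + b) * c.h + i) / c.h = ((m : ℕ) - 1) * c.bits + b := by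
    rw [mul_comm, Nat.mul_add_div (by omega), Nat.div_eq_of_lt hi, add_zero]
  have hjd : (((m : ℕ) - 1) * c.bits + b) / c.bits + 1 = m := by
    rw [mul_comm, Nat.mul_add_div (by omega), Nat.div_eq_of_lt hb, add_zero]
    omega
  have hjm : (((m : ℕ) - 1) * c.bits + b) % c.bits = b := by
    rw [mul_comm, Nat.mul_add_mod, Nat.mod_eq_of_lt hb]
  simp only [leaderArm, hdiv, hmod, hj, hjd, hjm, ho, if_true, m.2, dif_pos]

/-- For a digit 1 the leader collides with the follower. For a digit 0 every player is on her own
communication arm, so nobody collides and the raw loss is visible. -/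
theorem obs_block {m : Fin M} (hm : m ≠ c.leader) {p b i : ℕ} (hb : b < c.bits)
    (hi : i < c.h) :
    c.obs l a (p * c.phaseLen + (((m : ℕ) - 1) * c.bits + b) * c.h + i) m =
      if (a p m : ℕ).testBit b then 1
      else l (p * c.phaseLen + (((m : ℕ) - 1) * c.bits + b) * c.h + i) (c.commArm m) := by
  have ho := c.block_offset_lt hm hb hi
  have hlead := c.leaderArm_block a hm (p := p) hb hi
  have hmod : (p * c.phaseLen + (((m : ℕ) - 1) * c.bits + b) * c.h + i) % c.phaseLen <
      c.commLen := by
    rw [add_assoc, mul_comm, Nat.mul_add_mod]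
    exact (Nat.mod_le _ _).trans_lt ho
  generalize p * c.phaseLen + (((m : ℕ) - 1) * c.bits + b) * c.h + i = t at hlead hmod ⊢
  have harm := c.arm_of_ne_leader_of_comm a hm hmod
  rw [obs_eq]
  split_ifs at hlead ⊢ with hbit
  · refine received_of_collision hm ?_ _
    rw [harm, arm, if_pos rfl, hlead]
  · have : (fun n => c.arm a n t fun s : Fin t => c.obs l a s n) = c.commArm := by
      funext n
      by_cases hn : n = c.leader
      · rw [arm, if_pos hn, hlead, hn]
      · exact c.arm_of_ne_leader_of_comm a hn hmod _
    rw [this, received_of_injective c.commArm_injective]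

/-- The repetition code is decoded correctly when it is longer than all runs of ones. -/
theorem decode_eq {T : ℕ} (hW : localAttackability l T < c.h) {m : Fin M} (hm : m ≠ c.leader)
    {t : ℕ} (htT : t ≤ T) (ht : c.commLen ≤ t % c.phaseLen) :
    c.decode m (t / c.phaseLen) t (fun s => c.obs l a s m) = a (t / c.phaseLen) m := by
  classical
  have hlt : (a (t / c.phaseLen) m : ℕ) < 2 ^ c.bits :=
    (a (t / c.phaseLen) m).2.trans_le (Nat.le_pow_clog (by norm_num) _)
  rw [← Nat.mod_eq_of_lt hlt, ← sum_range_testBit, decode]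
  refine Finset.sum_congr rfl fun b hb => ?_
  rw [Finset.mem_range] at hb
  have htp : t / c.phaseLen * c.phaseLen + t % c.phaseLen = t := Nat.div_add_mod' _ _
  -- The whole block lies before `t`, so the test over `Fin t` in `decode` really covers all `h`
  -- slots. The offset `c.h - 1` is the last slot of the block; `c.h` is positive by `hW`.
  have hend : t / c.phaseLen * c.phaseLen + (((m : ℕ) - 1) * c.bits + b) * c.h + c.h ≤ t := by
    have := c.block_offset_lt hm hb (i := c.h - 1) (by omega)
    omega
  refine if_congr ?_ rfl rfl
  constructor
  · intro hall
    by_contra hbit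
    obtain ⟨i, hi, hne⟩ := exists_ne_one_of_localAttackability_lt hW (c.commArm m)
      (hend.trans htT)
    refine hne ?_
    have := hall ⟨t / c.phaseLen * c.phaseLen + (((m : ℕ) - 1) * c.bits + b) * c.h + i,
      by omega⟩ (Nat.le_add_right _ _) (by simpa using hi)
    rwa [c.obs_block l a hm hb hi, if_neg hbit] at this
  · intro hbit s hs1 hs2
    obtain ⟨i, hi⟩ := Nat.exists_eq_add_of_le hs1
    rw [hi, c.obs_block l a hm hb (by omega), if_pos hbit]

/-- In an exploration slot all players are on their assigned arms. -/
theorem obs_exploration {T : ℕ} (hW : localAttackability l T < c.h)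
    (ha : ∀ p, Function.Injective (a p)) {t : ℕ} (htT : t ≤ T)
    (ht : c.commLen ≤ t % c.phaseLen) (m : Fin M) :
    c.obs l a t m = l t (a (t / c.phaseLen) m) := by
  have : (fun n => c.arm a n t fun s : Fin t => c.obs l a s n) = a (t / c.phaseLen) := by
    funext n
    by_cases hn : n = c.leader
    · rw [arm, if_pos hn, leaderArm, hn]
      exact if_neg ht.not_gt
    · have hd := c.decode_eq l a hW hn htT ht
      rw [arm, if_neg hn, followerArm, if_neg ht.not_gt, dif_pos (by rw [hd]; exact Fin.is_lt _)]
      exact Fin.ext hd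
  rw [obs_eq, this, received_of_injective (ha _)]

/-- The loss of arm `k` in the exploration part of phase `p`. -/
def explorationLoss (p : ℕ) (k : Fin K) : ℝ :=
  ∑ i ∈ Finset.range c.τ, l (p * c.phaseLen + c.commLen + i) k

theorem obs_exploration_offset {T : ℕ} (hW : localAttackability l T < c.h)
    (ha : ∀ p, Function.Injective (a p)) {p i : ℕ} (hi : i < c.τ)
    (hp : (p + 1) * c.phaseLen ≤ T) (m : Fin M) :
    c.obs l a (p * c.phaseLen + c.commLen + i) m =
      l (p * c.phaseLen + c.commLen + i) (a p m) := by
  have hlt : c.commLen + i < c.phaseLen := Nat.add_lt_add_left hi _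
  have hp' : (p + 1) * c.phaseLen = p * c.phaseLen + c.phaseLen := by ring
  have hdiv : (p * c.phaseLen + c.commLen + i) / c.phaseLen = p := by
    rw [add_assoc, mul_comm, Nat.mul_add_div (by omega), Nat.div_eq_of_lt hlt, add_zero]
  have hmod : (p * c.phaseLen + c.commLen + i) % c.phaseLen = c.commLen + i := by
    rw [add_assoc, mul_comm, Nat.mul_add_mod, Nat.mod_eq_of_lt hlt]
  rw [c.obs_exploration l a hW ha (by omega) (by omega), hdiv]

theorem phaseLoss_obs {T : ℕ} (hW : localAttackability l T < c.h)
    (ha : ∀ p, Function.Injective (a p)) {p : ℕ} (hp : (p + 1) * c.phaseLen ≤ T) :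
    c.phaseLoss (fun t => c.obs l a t c.leader) p = c.explorationLoss l p (a p c.leader) :=
  Finset.sum_congr rfl fun _ hi =>
    c.obs_exploration_offset l a hW ha (Finset.mem_range.1 hi) hp _

/-- Used to show that appending a later draw leaves the earlier estimates unchanged. -/
theorem cumEstimate_congr {a a' : ℕ → Fin M → Fin K} {x x' : ℕ → ℝ} {p : ℕ}
    (ha : ∀ q < p, a q = a' q) (hx : ∀ q < p, c.phaseLoss x q = c.phaseLoss x' q) :
    c.cumEstimate a x p = c.cumEstimate a' x' p := by
  induction p with
  | zero => rfl
  | succ p ih =>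
    have ih' := ih (fun q hq => ha q (by omega)) fun q hq => hx q (by omega)
    funext k
    simp only [cumEstimate, ih', ha p (Nat.lt_succ_self p), hx p (Nat.lt_succ_self p)]

end Config

/-! ### Histories of draws and the recursion of their law. -/

namespace Config

variable (c : Config M K) (l : ℕ → Fin K → ℝ)

theorem extend_snoc_of_lt {p : ℕ} (a : Fin p → Fin M → Fin K) (b : Fin M → Fin K) {q : ℕ}
    (hq : q < p) :
    c.extend (Fin.snoc (α := fun _ => Fin M → Fin K) a b) q = c.extend a q := by
  rw [extend, extend, dif_pos hq, dif_pos (Nat.lt_succ_of_lt hq)]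
  exact Fin.snoc_castSucc (α := fun _ => Fin M → Fin K) b a ⟨q, hq⟩

theorem extend_snoc_self {p : ℕ} (a : Fin p → Fin M → Fin K) (b : Fin M → Fin K) :
    c.extend (Fin.snoc (α := fun _ => Fin M → Fin K) a b) p = b := by
  rw [extend, dif_pos (Nat.lt_succ_self p)]
  exact Fin.snoc_last (α := fun _ => Fin M → Fin K) b a

/-- The leader's cumulative loss estimates after the phases whose draws are `a`. -/
noncomputable def histEstimate {p : ℕ} (a : Fin p → Fin M → Fin K) : Fin K → ℝ :=
  c.cumEstimate (c.extend a) (fun t => c.obs l (c.extend a) t c.leader) p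

theorem pmfMean_law_zero (f : (Fin 0 → Fin M → Fin K) → ℝ) :
    pmfMean (c.law l 0) f = f fun i => i.elim0 := pmfMean_pure _ _

theorem pmfMean_law_succ (p : ℕ) (f : (Fin (p + 1) → Fin M → Fin K) → ℝ) :
    pmfMean (c.law l (p + 1)) f = pmfMean (c.law l p) fun a =>
      pmfMean (c.assignLaw (c.histEstimate l a)) fun b =>
        f (Fin.snoc (α := fun _ => Fin M → Fin K) a b) := by
  rw [law, pmfMean_bind]
  simp only [pmfMean_map, histEstimate]

/-- Undrawn phases default to the injective `commArm`, so injectivity holds at every index, as the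
decoding lemmas require. -/
theorem extend_injective_of_law_ne_zero {p : ℕ} {a : Fin p → Fin M → Fin K}
    (ha : c.law l p a ≠ 0) (q : ℕ) : Function.Injective (c.extend a q) := by
  induction p with
  | zero => exact c.commArm_injective
  | succ p ih =>
    rw [← PMF.mem_support_iff, law, PMF.mem_support_bind_iff] at ha
    obtain ⟨a', ha', hb⟩ := ha
    rw [PMF.mem_support_map_iff] at hb
    obtain ⟨b, hb, rfl⟩ := hb
    rcases lt_trichotomy q p with hq | rfl | hq
    · rw [extend_snoc_of_lt _ _ _ hq]
      exact ih ha'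
    · rw [extend_snoc_self]
      exact c.injective_of_assignLaw_ne_zero _ hb
    · rw [extend, dif_neg (by omega)]
      exact c.commArm_injective

theorem extend_snoc_injective {p : ℕ} {a : Fin p → Fin M → Fin K} {b : Fin M → Fin K}
    (ha : ∀ q, Function.Injective (c.extend a q)) (hb : Function.Injective b) (q : ℕ) :
    Function.Injective (c.extend (Fin.snoc (α := fun _ => Fin M → Fin K) a b) q) := by
  rcases lt_trichotomy q p with hq | rfl | hq
  · rw [extend_snoc_of_lt _ _ _ hq]
    exact ha q
  · rwa [extend_snoc_self]
  · rw [extend, dif_neg (by omega)]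
    exact c.commArm_injective

variable {l} {T : ℕ}

/-- Exact decoding turns every recorded phase loss into the `explorationLoss` of the leader's arm.
The past is then independent of the new draw, and the update touches one arm only. -/
theorem histEstimate_snoc (hW : localAttackability l T < c.h) {p : ℕ}
    (hp : (p + 1) * c.phaseLen ≤ T) {a : Fin p → Fin M → Fin K} {b : Fin M → Fin K}
    (ha : ∀ q, Function.Injective (c.extend a q)) (hb : Function.Injective b) :
    c.histEstimate l (Fin.snoc (α := fun _ => Fin M → Fin K) a b) = fun k =>
      c.histEstimate l a k + if b c.leader = k then
        (M : ℝ) / c.τ * (c.explorationLoss l p (b c.leader) /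
          armProb M c.η (c.histEstimate l a) (b c.leader)) else 0 := by
  have hinj := c.extend_snoc_injective ha hb
  have hprev : c.cumEstimate (c.extend (Fin.snoc (α := fun _ => Fin M → Fin K) a b))
      (fun t => c.obs l (c.extend (Fin.snoc (α := fun _ => Fin M → Fin K) a b)) t c.leader) p =
      c.histEstimate l a := by
    refine c.cumEstimate_congr (fun q hq => c.extend_snoc_of_lt a b hq) fun q hq => ?_
    have hq' : (q + 1) * c.phaseLen ≤ T :=
      (Nat.mul_le_mul_right _ (by omega)).trans hp
    rw [c.phaseLoss_obs l _ hW hinj hq', c.phaseLoss_obs l _ hW ha hq',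
      c.extend_snoc_of_lt a b hq]
  funext k
  change c.cumEstimate _ _ p k + c.estimate (c.cumEstimate _ _ p) (c.extend _ p c.leader)
    (c.phaseLoss _ p) k = _
  rw [hprev, c.phaseLoss_obs l _ hW hinj hp, extend_snoc_self]
  unfold estimate
  split_ifs with h
  · subst h
    rfl
  · rfl

theorem explorationLoss_mem_Icc (hl : ∀ t < T, ∀ k, l t k ∈ Set.Icc (0 : ℝ) 1) {p : ℕ}
    (hp : (p + 1) * c.phaseLen ≤ T) (k : Fin K) :
    c.explorationLoss l p k ∈ Set.Icc (0 : ℝ) c.τ := by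
  have hmem : ∀ i ∈ Finset.range c.τ,
      l (p * c.phaseLen + c.commLen + i) k ∈ Set.Icc (0 : ℝ) 1 := by
    intro i hi
    refine hl _ ?_ k
    rw [Finset.mem_range] at hi
    rw [add_mul, one_mul] at hp
    unfold phaseLen at hp ⊢
    omega
  refine ⟨Finset.sum_nonneg fun i hi => (hmem i hi).1, ?_⟩
  simpa [explorationLoss] using Finset.sum_le_sum fun i hi => (hmem i hi).2

/-- The loss of all players in the exploration parts of the first `p` phases. -/
def playersLoss (l : ℕ → Fin K → ℝ) (p : ℕ) (a : ℕ → Fin M → Fin K) : ℝ :=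
  ∑ q ∈ Finset.range p, ∑ m, c.explorationLoss l q (a q m)

theorem playersLoss_snoc {p : ℕ} (a : Fin p → Fin M → Fin K) (b : Fin M → Fin K) :
    c.playersLoss l p (c.extend (Fin.snoc (α := fun _ => Fin M → Fin K) a b)) =
      c.playersLoss l p (c.extend a) :=
  Finset.sum_congr rfl fun q hq => by rw [c.extend_snoc_of_lt a b (Finset.mem_range.1 hq)]

theorem playersLoss_succ_snoc {p : ℕ} (a : Fin p → Fin M → Fin K) (b : Fin M → Fin K) :
    c.playersLoss l (p + 1) (c.extend (Fin.snoc (α := fun _ => Fin M → Fin K) a b)) =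
      c.playersLoss l p (c.extend a) + ∑ m, c.explorationLoss l p (b m) := by
  rw [← playersLoss_snoc c a b, playersLoss, Finset.sum_range_succ, extend_snoc_self, playersLoss]

/-- The loss estimates are unbiased. -/
theorem pmfMean_histEstimate (hτ : 0 < c.τ) (hW : localAttackability l T < c.h) (k : Fin K)
    {p : ℕ} (hp : p * c.phaseLen ≤ T) :
    pmfMean (c.law l p) (fun a => c.histEstimate l a k) =
      (c.τ : ℝ)⁻¹ * ∑ q ∈ Finset.range p, c.explorationLoss l q k := by
  have hM : (M : ℝ) ≠ 0 := by
    have := c.one_lt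
    positivity
  induction p with
  | zero => simp [pmfMean_law_zero, histEstimate, cumEstimate]
  | succ p ih =>
    have hp' : p * c.phaseLen ≤ T := (Nat.mul_le_mul_right _ (by omega)).trans hp
    rw [pmfMean_law_succ, Finset.sum_range_succ, mul_add, ← ih hp',
      ← pmfMean_const (c.law l p) ((c.τ : ℝ)⁻¹ * c.explorationLoss l p k), ← pmfMean_add]
    refine pmfMean_congr _ fun a ha => ?_
    obtain ⟨F, hF⟩ : ∃ F : Fin K → ℝ, F = fun j => if j = k then
        (M : ℝ) / c.τ * (c.explorationLoss l p j / armProb M c.η (c.histEstimate l a) j) else 0 :=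
      ⟨_, rfl⟩
    have hstep : pmfMean (c.assignLaw (c.histEstimate l a)) (fun b =>
        c.histEstimate l (Fin.snoc (α := fun _ => Fin M → Fin K) a b) k) =
        pmfMean (c.assignLaw (c.histEstimate l a)) (fun b => c.histEstimate l a k +
          F (b c.leader)) := by
      refine pmfMean_congr _ fun b hb => ?_
      rw [c.histEstimate_snoc hW hp (c.extend_injective_of_law_ne_zero l ha)
        (c.injective_of_assignLaw_ne_zero _ hb), hF]
    have hq := (armProb_pos (Nat.zero_lt_of_lt c.one_lt) c.le c.η (c.histEstimate l a) k).ne'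
    have hτ' : (c.τ : ℝ) ≠ 0 := by positivity
    rw [hstep, pmfMean_add, pmfMean_const, pmfMean_assignLaw_apply]
    simp only [hF, mul_ite, mul_zero, Finset.sum_ite_eq', Finset.mem_univ, if_true]
    -- The probability `armProb / M` of the leader being on arm `k` cancels the importance weight `M
    -- / armProb`.
    congr 1
    field_simp

/-- The potential argument of the exponential-weights algorithm. -/
theorem pmfMean_potential_le (hτ : 0 < c.τ) (hη : 0 ≤ c.η) (hW : localAttackability l T < c.h)
    (hl : ∀ t < T, ∀ k, l t k ∈ Set.Icc (0 : ℝ) 1) {p : ℕ} (hp : p * c.phaseLen ≤ T) :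
    pmfMean (c.law l p) (fun a => potential M c.η (c.histEstimate l a) +
        c.η / c.τ * c.playersLoss l p (c.extend a)) ≤
      Real.log (K.choose M) + p * (c.η ^ 2 / 2 * (M * K)) := by
  have hM : (0 : ℝ) < M := by
    have := c.one_lt
    positivity
  have hτ' : (0 : ℝ) < c.τ := by positivity
  induction p with
  | zero =>
    have h0 : c.histEstimate l (fun i : Fin 0 => i.elim0) = fun _ => 0 := rfl
    simp [pmfMean_law_zero, playersLoss, h0, potential_zero]
  | succ p ih =>
    have hp' : p * c.phaseLen ≤ T := (Nat.mul_le_mul_right _ (by omega)).trans hp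
    have hrec := ih hp'
    rw [pmfMean_law_succ]
    calc _ ≤ pmfMean (c.law l p) (fun a => (potential M c.η (c.histEstimate l a) +
          c.η / c.τ * c.playersLoss l p (c.extend a)) + c.η ^ 2 / 2 * (M * K)) := ?_
      _ ≤ _ := by
        rw [pmfMean_add, pmfMean_const]
        push_cast
        linarith
    refine pmfMean_mono _ fun a ha => ?_
    set L := c.histEstimate l a with hL
    set E := c.explorationLoss l p with hE
    have hq := armProb_pos (Nat.zero_lt_of_lt c.one_lt) c.le c.η L
    -- `F j` bounds the change of the potential when the leader is on `j`. Averaged with weights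
    -- `armProb / M`, its linear part cancels the mean loss of the players, and its quadratic part
    -- becomes `η² M K / 2`.
    obtain ⟨F, hF⟩ : ∃ F : Fin K → ℝ, F = fun j =>
        c.η ^ 2 / 2 * (M ^ 2 / armProb M c.η L j) - c.η * (M / c.τ * E j) := ⟨_, rfl⟩
    have hb : pmfMean (c.assignLaw L) (fun b =>
        potential M c.η (c.histEstimate l (Fin.snoc (α := fun _ => Fin M → Fin K) a b)) +
        c.η / c.τ *
          c.playersLoss l (p + 1) (c.extend (Fin.snoc (α := fun _ => Fin M → Fin K) a b))) ≤
        pmfMean (c.assignLaw L) (fun b =>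
          ((potential M c.η L + c.η / c.τ * c.playersLoss l p (c.extend a)) +
            F (b c.leader)) + c.η / c.τ * ∑ m, E (b m)) := by
      refine pmfMean_mono _ fun b hb => ?_
      rw [c.histEstimate_snoc hW hp (c.extend_injective_of_law_ne_zero l ha)
        (c.injective_of_assignLaw_ne_zero _ hb), playersLoss_succ_snoc, ← hL, ← hE]
      generalize b c.leader = j
      have hqj := hq j
      have hEj := c.explorationLoss_mem_Icc hl hp j
      rw [← hE] at hEj
      have hpot := potential_add_single_le c.le hη L j
        (e := (M : ℝ) / c.τ * (E j / armProb M c.η L j))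
        (mul_nonneg (by positivity) (div_nonneg hEj.1 hqj.le))
      have h1 : armProb M c.η L j * ((M : ℝ) / c.τ * (E j / armProb M c.η L j)) =
          M / c.τ * E j := by
        field_simp
      have h2 : armProb M c.η L j * ((M : ℝ) / c.τ * (E j / armProb M c.η L j)) ^ 2 ≤
          M ^ 2 / armProb M c.η L j := by
        have h3 : armProb M c.η L j * ((M : ℝ) / c.τ * (E j / armProb M c.η L j)) ^ 2 =
            M ^ 2 / armProb M c.η L j * (E j / c.τ) ^ 2 := by
          field_simp
        rw [h3]
        refine mul_le_of_le_one_right (by positivity) ?_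
        exact pow_le_one₀ (div_nonneg hEj.1 hτ'.le) ((div_le_one hτ').2 hEj.2)
      rw [h1] at hpot
      have h4 := mul_le_mul_of_nonneg_left h2 (by positivity : (0 : ℝ) ≤ c.η ^ 2 / 2)
      rw [mul_add, hF]
      linarith
    refine hb.trans (le_of_eq ?_)
    rw [pmfMean_add, pmfMean_add, pmfMean_const, pmfMean_assignLaw_apply, pmfMean_const_mul,
      pmfMean_assignLaw_sum]
    have h5 : ∑ k, armProb M c.η L k * F k =
        K * (c.η ^ 2 / 2 * M ^ 2) - c.η * (M / c.τ) * ∑ k, armProb M c.η L k * E k := by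
      rw [Finset.mul_sum, ← nsmul_eq_mul]
      conv_rhs => enter [1, 1]; rw [← Fintype.card_fin K, ← Finset.card_univ]
      rw [← Finset.sum_const, ← Finset.sum_sub_distrib]
      refine Finset.sum_congr rfl fun k _ => ?_
      have := (hq k).ne'
      rw [hF]
      field_simp
    rw [h5]
    field_simp
    ring

/-- The expected exploration regret of the exponential-weights algorithm. -/
theorem pmfMean_playersLoss_le (hτ : 0 < c.τ) (hη : 0 < c.η) (hW : localAttackability l T < c.h)
    (hl : ∀ t < T, ∀ k, l t k ∈ Set.Icc (0 : ℝ) 1) {p : ℕ} (hp : p * c.phaseLen ≤ T)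
    (κ : Fin M ↪ Fin K) :
    pmfMean (c.law l p) (fun a => c.playersLoss l p (c.extend a)) ≤
      c.playersLoss l p (fun _ => κ) +
        (c.τ * Real.log (K.choose M) / c.η + p * c.τ * (c.η / 2 * (M * K))) := by
  have hτ' : (0 : ℝ) < c.τ := by positivity
  have hpot := c.pmfMean_potential_le hτ hη.le hW hl hp
  rw [pmfMean_add, pmfMean_const_mul] at hpot
  let A : MetaArm M K := ⟨Finset.univ.map κ, by simp⟩
  have hA : pmfMean (c.law l p) (fun a => -c.η * ∑ m, c.histEstimate l a (κ m)) ≤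
      pmfMean (c.law l p) (fun a => potential M c.η (c.histEstimate l a)) := by
    refine pmfMean_mono _ fun a _ => ?_
    have := neg_mul_sum_le_potential c.η (c.histEstimate l a) A
    rwa [Finset.sum_map] at this
  have hcomp : pmfMean (c.law l p) (fun a => -c.η * ∑ m, c.histEstimate l a (κ m)) =
      -(c.η / c.τ * c.playersLoss l p (fun _ => κ)) := by
    rw [pmfMean_const_mul, pmfMean_sum]
    simp only [c.pmfMean_histEstimate hτ hW _ hp]
    rw [← Finset.mul_sum, Finset.sum_comm, playersLoss]
    ring
  rw [hcomp] at hA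
  have hmain : c.η / c.τ * pmfMean (c.law l p) (fun a => c.playersLoss l p (c.extend a)) ≤
      c.η / c.τ * (c.playersLoss l p (fun _ => κ) +
        (c.τ * Real.log (K.choose M) / c.η + p * c.τ * (c.η / 2 * (M * K)))) := by
    have : c.η / c.τ * (c.playersLoss l p (fun _ => κ) +
        (c.τ * Real.log (K.choose M) / c.η + p * c.τ * (c.η / 2 * (M * K)))) =
        c.η / c.τ * c.playersLoss l p (fun _ => κ) + (Real.log (K.choose M) +
          p * (c.η ^ 2 / 2 * (M * K))) := by
      field_simp
    rw [this]
    linarith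
  exact le_of_mul_le_mul_left hmain (by positivity)

/-- If every arm is played in every exploration phase, there is no exploration regret. -/
theorem pmfMean_playersLoss_of_eq (hMK : M = K) (p : ℕ) (κ : Fin M ↪ Fin K) :
    pmfMean (c.law l p) (fun a => c.playersLoss l p (c.extend a)) =
      c.playersLoss l p (fun _ => κ) := by
  subst hMK
  rw [← pmfMean_const (c.law l p) (c.playersLoss l p fun _ => κ)]
  refine pmfMean_congr _ fun a ha => Finset.sum_congr rfl fun q _ => ?_
  have h : ∀ f : Fin M → Fin M, Function.Injective f →
      ∑ m, c.explorationLoss l q (f m) = ∑ m, c.explorationLoss l q m := fun f hf =>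
    (Finite.injective_iff_bijective.1 hf).sum_comp (c.explorationLoss l q)
  rw [h _ (c.extend_injective_of_law_ne_zero l ha q), h _ κ.injective]

/-! ### From exploration loss to regret. -/

theorem sum_range_mul_phaseLen_le (f : ℕ → ℝ) (g : ℕ → ℝ) (B : ℝ) (p : ℕ)
    (hf : ∀ t < p * c.phaseLen, f t ≤ B)
    (hg : ∀ q < p, ∑ i ∈ Finset.range c.τ, f (q * c.phaseLen + c.commLen + i) = g q) :
    ∑ t ∈ Finset.range (p * c.phaseLen), f t ≤
      p * c.commLen * B + ∑ q ∈ Finset.range p, g q := by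
  induction p with
  | zero => simp
  | succ p ih =>
    have hs : (p + 1) * c.phaseLen = p * c.phaseLen + c.commLen + c.τ := by
      unfold phaseLen
      ring
    have ih' := ih (fun t ht => hf t (by omega)) fun q hq => hg q (by omega)
    rw [hs, Finset.sum_range_add, Finset.sum_range_add, hg p (Nat.lt_succ_self p),
      Finset.sum_range_succ]
    have hc : ∑ i ∈ Finset.range c.commLen, f (p * c.phaseLen + i) ≤ c.commLen * B := by
      have := Finset.sum_le_card_nsmul (Finset.range c.commLen)
        (fun i => f (p * c.phaseLen + i)) B fun i hi => hf _ (by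
          rw [Finset.mem_range] at hi
          omega)
      simpa using this
    push_cast
    linarith

/-- Everything outside the complete exploration phases contributes at most `M` per slot. -/
theorem sum_obs_sub_le (hl : ∀ t < T, ∀ k, l t k ∈ Set.Icc (0 : ℝ) 1)
    (hW : localAttackability l T < c.h) (hτ : 0 < c.τ) {a : ℕ → Fin M → Fin K}
    (ha : ∀ q, Function.Injective (a q)) (κ : Fin M ↪ Fin K) :
    ∑ t ∈ Finset.range T, ∑ m, c.obs l a t m - ∑ t ∈ Finset.range T, ∑ m, l t (κ m) ≤
      M * ((T / c.phaseLen : ℕ) * c.commLen) + M * min (T : ℝ) c.phaseLen +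
        (c.playersLoss l (T / c.phaseLen) a - c.playersLoss l (T / c.phaseLen) fun _ => κ) := by
  set p := T / c.phaseLen with hp
  have hpos : 0 < c.phaseLen := Nat.add_pos_right _ hτ
  have hpT : p * c.phaseLen ≤ T := Nat.div_mul_le_self _ _
  set f : ℕ → ℝ := fun t => ∑ m, c.obs l a t m - ∑ m, l t (κ m) with hf
  have hfM : ∀ t < T, f t ≤ M := by
    intro t ht
    have h1 : ∑ m, c.obs l a t m ≤ M := by
      simpa using Finset.sum_le_sum fun m (_ : m ∈ Finset.univ) => (c.obs_mem_Icc l a (hl t ht) m).2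
    have h2 : 0 ≤ ∑ m, l t (κ m) := Finset.sum_nonneg fun m _ => (hl t ht _).1
    simp only [hf]
    linarith
  have hmain := c.sum_range_mul_phaseLen_le f
    (fun q => ∑ m, c.explorationLoss l q (a q m) - ∑ m, c.explorationLoss l q (κ m)) M p
    (fun t ht => hfM t (by omega)) (by
      intro q hq
      have hq' : (q + 1) * c.phaseLen ≤ T := (Nat.mul_le_mul_right _ (by omega)).trans hpT
      simp only [hf, explorationLoss]
      rw [Finset.sum_sub_distrib, Finset.sum_comm (s := Finset.range c.τ),
        Finset.sum_comm (s := Finset.range c.τ)]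
      congr 1
      refine Finset.sum_congr rfl fun m _ => Finset.sum_congr rfl fun i hi => ?_
      exact c.obs_exploration_offset l a hW ha (Finset.mem_range.1 hi) hq' m)
  have hT : T = p * c.phaseLen + T % c.phaseLen := (Nat.div_add_mod' _ _).symm
  have hrest : ∑ i ∈ Finset.range (T % c.phaseLen), f (p * c.phaseLen + i) ≤
      (T % c.phaseLen : ℕ) * M := by
    have := Finset.sum_le_card_nsmul (Finset.range (T % c.phaseLen))
      (fun i => f (p * c.phaseLen + i)) M fun i hi => hfM _ (by
        rw [Finset.mem_range] at hi
        omega)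
    simpa using this
  -- Both bounds on the incomplete phase are kept, since a phase may be longer than the horizon.
  have hmin : ((T % c.phaseLen : ℕ) : ℝ) ≤ min (T : ℝ) c.phaseLen :=
    le_min (by exact_mod_cast Nat.mod_le _ _) (by exact_mod_cast (Nat.mod_lt _ hpos).le)
  have hmin' := mul_le_mul_of_nonneg_right hmin (Nat.cast_nonneg (α := ℝ) M)
  rw [← Finset.sum_sub_distrib]
  change ∑ t ∈ Finset.range T, f t ≤ _
  conv_lhs => rw [hT, Finset.sum_range_add]
  rw [Finset.sum_sub_distrib (s := Finset.range p)] at hmain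
  unfold playersLoss
  linarith

theorem nonempty_embedding (c : Config M K) : Nonempty (Fin M ↪ Fin K) := ⟨Fin.castLEEmb c.le⟩

theorem expectedRegret_le_of_playersLoss_le (hl : ∀ t < T, ∀ k, l t k ∈ Set.Icc (0 : ℝ) 1)
    (hW : localAttackability l T < c.h) (hτ : 0 < c.τ) {B : ℝ}
    (hB : ∀ κ : Fin M ↪ Fin K, pmfMean (c.law l (T / c.phaseLen))
      (fun a => c.playersLoss l (T / c.phaseLen) (c.extend a)) ≤
        c.playersLoss l (T / c.phaseLen) (fun _ => κ) + B) :
    c.expectedRegret l T ≤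
      M * ((T / c.phaseLen : ℕ) * c.commLen) + M * min (T : ℝ) c.phaseLen + B := by
  have := c.nonempty_embedding
  obtain ⟨κ, hκ⟩ := exists_eq_ciInf_of_finite
    (f := fun k : Fin M ↪ Fin K => ∑ t ∈ Finset.range T, ∑ m, l t (k m))
  have h1 : c.expectedRegret l T ≤ pmfMean (c.law l (T / c.phaseLen + 1)) (fun a =>
      (M * ((T / c.phaseLen : ℕ) * c.commLen) + M * min (T : ℝ) c.phaseLen -
        c.playersLoss l (T / c.phaseLen) fun _ => κ) +
        c.playersLoss l (T / c.phaseLen) (c.extend a)) := by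
    change pmfMean (c.law l (T / c.phaseLen + 1)) (fun a => c.regret l T (c.extend a)) ≤ _
    refine pmfMean_mono _ fun a ha => ?_
    rw [regret, ← hκ]
    have := c.sum_obs_sub_le hl hW hτ (c.extend_injective_of_law_ne_zero l ha) κ
    linarith
  -- The draw of the incomplete phase does not affect the complete ones, so it integrates out.
  rw [pmfMean_add, pmfMean_const, pmfMean_law_succ] at h1
  simp only [playersLoss_snoc, pmfMean_const] at h1
  linarith [hB κ]

/-- The trivial bound on the regret. -/
theorem expectedRegret_le_mul (hl : ∀ t < T, ∀ k, l t k ∈ Set.Icc (0 : ℝ) 1) :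
    c.expectedRegret l T ≤ M * T := by
  have := c.nonempty_embedding
  rw [← pmfMean_const (c.law l (T / c.phaseLen + 1)) ((M : ℝ) * T)]
  change pmfMean (c.law l (T / c.phaseLen + 1)) (fun a => c.regret l T (c.extend a)) ≤ _
  refine pmfMean_mono _ fun a _ => ?_
  have h1 : ∑ t ∈ Finset.range T, ∑ m, c.obs l (c.extend a) t m ≤ T * M := by
    have := Finset.sum_le_card_nsmul (Finset.range T)
      (fun t => ∑ m, c.obs l (c.extend a) t m) M fun t ht => by
        simpa using Finset.sum_le_sum fun m (_ : m ∈ Finset.univ) =>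
          (c.obs_mem_Icc l (c.extend a) (hl t (Finset.mem_range.1 ht)) m).2
    simpa using this
  have h2 : 0 ≤ ⨅ k : Fin M ↪ Fin K, ∑ t ∈ Finset.range T, ∑ m, l t (k m) :=
    le_ciInf fun k => Finset.sum_nonneg fun t ht => Finset.sum_nonneg fun m _ =>
      (hl t (Finset.mem_range.1 ht) _).1
  rw [regret]
  linarith

/-- The regret bound for the optimal learning rate. -/
theorem expectedRegret_le_sqrt (hl : ∀ t < T, ∀ k, l t k ∈ Set.Icc (0 : ℝ) 1)
    (hW : localAttackability l T < c.h) (hτ : 0 < c.τ) (hT : 0 < T)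
    (hη : c.η = Real.sqrt (Real.log (K.choose M) * c.τ / (M * K * T))) :
    c.expectedRegret l T ≤
      M * ((T / c.phaseLen : ℕ) * c.commLen) + M * min (T : ℝ) c.phaseLen +
        3 / 2 * Real.sqrt (Real.log (K.choose M) * c.τ * (M * K * T)) := by
  have hM := c.one_lt
  have hK := c.le
  refine c.expectedRegret_le_of_playersLoss_le hl hW hτ fun κ => ?_
  -- For `M = K` the logarithm vanishes and `η = 0`, so the bound that divides by `η` is
  -- unavailable; here there is no exploration regret at all.
  rcases hK.eq_or_lt with hMK | hMK
  · rw [c.pmfMean_playersLoss_of_eq hMK]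
    exact le_add_of_nonneg_right (by positivity)
  have hτ' : (0 : ℝ) < c.τ := by positivity
  have hN : (0 : ℝ) < M * K * T := by
    have : 0 < K := by omega
    positivity
  have hlog : 0 < Real.log (K.choose M) := by
    refine Real.log_pos ?_
    have h1 : K.choose M ≠ 1 := by
      rw [Ne, Nat.choose_eq_one_iff]
      omega
    have h2 := Nat.choose_pos hK
    exact_mod_cast (by omega : 1 < K.choose M)
  have hη0 : 0 < c.η := by
    rw [hη]
    positivity
  have hpT : (T / c.phaseLen : ℕ) * (c.τ : ℝ) ≤ T := by
    have h1 : T / c.phaseLen * c.τ ≤ T :=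
      (Nat.mul_le_mul_left _ (Nat.le_add_left _ _)).trans (Nat.div_mul_le_self _ c.phaseLen)
    exact_mod_cast h1
  refine (c.pmfMean_playersLoss_le hτ hη0 hW hl (Nat.div_mul_le_self _ _) κ).trans ?_
  refine add_le_add_right ?_ _
  set N : ℝ := M * K * T with hNdef
  set S := Real.sqrt (Real.log (K.choose M) * c.τ * N) with hS
  -- With this learning rate the entropy term equals `S` and the variance term is at most `S / 2`.
  have hηN : c.η * N = S := by
    rw [hη, hS, Real.sqrt_div (by positivity),
      Real.sqrt_mul (by positivity : 0 ≤ Real.log (K.choose M) * (c.τ : ℝ)), div_mul_eq_mul_div,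
      mul_div_assoc, Real.div_sqrt]
  have hSS : S * S = Real.log (K.choose M) * c.τ * N := Real.mul_self_sqrt (by positivity)
  have h1 : c.τ * Real.log (K.choose M) / c.η = S := by
    rw [div_eq_iff hη0.ne']
    have : (c.τ * Real.log (K.choose M)) * N = (S * c.η) * N := by
      rw [mul_assoc S, hηN, hSS]
      ring
    exact mul_right_cancel₀ hN.ne' this
  have h2 : (T / c.phaseLen : ℕ) * (c.τ : ℝ) * (c.η / 2 * (M * K)) ≤ S / 2 := by
    calc _ ≤ (T : ℝ) * (c.η / 2 * (M * K)) :=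
          mul_le_mul_of_nonneg_right hpT (by positivity)
      _ = c.η * N / 2 := by
          rw [hNdef]
          ring
      _ = S / 2 := by rw [hηN]
  linarith

end Config

/-! ### Balancing the parameters. -/

theorem half_le_log_two : (1 / 2 : ℝ) ≤ Real.log 2 := by
  linarith [Real.log_two_gt_d9]

theorem log_two_le_log_natCast (hK : 2 ≤ K) : Real.log 2 ≤ Real.log K :=
  Real.log_le_log (by norm_num) (by exact_mod_cast hK)

theorem one_le_mul_log (hK : 2 ≤ K) : (1 : ℝ) ≤ K * Real.log K := by
  have h1 := half_le_log_two.trans (log_two_le_log_natCast hK)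
  have h2 : (2 : ℝ) ≤ K := by exact_mod_cast hK
  nlinarith

/-- From `2 ^ (clog - 1) < K` one gets `clog - 1 ≤ 2 log K`, and the missing 1 is at most `2 log K`
because `log 2 ≥ 1/2`. -/
theorem clog_two_le (hK : 2 ≤ K) : (Nat.clog 2 K : ℝ) ≤ 4 * Real.log K := by
  have h1 := log_two_le_log_natCast hK
  have h2 := half_le_log_two
  have hpos : 0 < Nat.clog 2 K := Nat.clog_pos (by norm_num) hK
  have hlt := Nat.pow_pred_clog_lt_self (b := 2) (x := K) (by norm_num) (by omega)
  have h3 : ((Nat.clog 2 K).pred : ℝ) * Real.log 2 ≤ Real.log K := by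
    rw [← Real.log_pow]
    refine Real.log_le_log (by positivity) ?_
    exact_mod_cast hlt.le
  have h4 : (Nat.clog 2 K : ℝ) = (Nat.clog 2 K).pred + 1 := by
    exact_mod_cast (Nat.succ_pred_eq_of_pos hpos).symm
  have h5 : (0 : ℝ) ≤ (Nat.clog 2 K).pred := Nat.cast_nonneg _
  nlinarith

theorem log_choose_le (hMK : M ≤ K) : Real.log (K.choose M) ≤ M * Real.log K := by
  rw [← Real.log_pow]
  refine Real.log_le_log (by exact_mod_cast Nat.choose_pos hMK) ?_
  exact_mod_cast Nat.choose_le_pow K M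

theorem min_add_le {x y z : ℝ} (hx : 0 ≤ x) (hy : 0 ≤ y) (hz : 0 ≤ z) :
    min x (y + z) ≤ min x y + min x z := by
  rcases le_total x y with h1 | h1 <;> rcases le_total x z with h2 | h2 <;>
    rcases le_total x (y + z) with h3 | h3 <;> simp only [min_eq_left, min_eq_right, *] <;> linarith

/-- The regret bound in terms of a rate `B` and an exploration length `τ₀` that balance the costs
of communication and of exploration. -/
theorem Config.expectedRegret_le_rate (c : Config M K) {l : ℕ → Fin K → ℝ} {T : ℕ}
    (hl : ∀ t < T, ∀ k, l t k ∈ Set.Icc (0 : ℝ) 1) (hW : localAttackability l T < c.h)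
    (hT : 0 < T) (hη : c.η = Real.sqrt (Real.log (K.choose M) * c.τ / (M * K * T)))
    {C X B τ₀ : ℝ} (hC : 0 ≤ C) (hX : 0 ≤ X) (hh : (c.h : ℝ) ≤ C * X) (hB : 0 ≤ B)
    (hτ₀ : 0 < τ₀) (hτ : τ₀ ≤ c.τ) (hτ' : (c.τ : ℝ) ≤ 2 * τ₀)
    (hcomm : B * τ₀ = M ^ 2 * Real.log K * (T * X))
    (hexpl : B ^ 2 = M ^ 2 * K * Real.log K * T * τ₀) :
    c.expectedRegret l T ≤ (8 * C + 6) * B := by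
  have hM2 := c.one_lt
  have hMK := c.le
  have hK2 : 2 ≤ K := by omega
  have hT' : (0 : ℝ) < T := by exact_mod_cast hT
  have hM' : (0 : ℝ) < M := by positivity
  have hτpos : (0 : ℝ) < c.τ := hτ₀.trans_le hτ
  have hlog : 0 < Real.log K := by linarith [half_le_log_two, log_two_le_log_natCast hK2]
  have hKlog := one_le_mul_log hK2
  have hcommLen : (c.commLen : ℝ) ≤ 4 * C * (M * Real.log K * X) := by
    have h1 : ((M - 1 : ℕ) : ℝ) ≤ M := by exact_mod_cast Nat.sub_le _ _
    have h2 : (c.bits : ℝ) ≤ 4 * Real.log K := clog_two_le hK2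
    calc (c.commLen : ℝ) = ((M - 1 : ℕ) : ℝ) * c.bits * c.h := by
          unfold commLen
          push_cast
          ring
      _ ≤ M * (4 * Real.log K) * (C * X) := by gcongr
      _ = _ := by ring
  have hcost : M * ((T / c.phaseLen : ℕ) * (c.commLen : ℝ)) ≤ 4 * C * B := by
    have h1 : ((T / c.phaseLen : ℕ) : ℝ) ≤ T / τ₀ := by
      rw [le_div_iff₀ hτ₀]
      have h2 : T / c.phaseLen * c.τ ≤ T :=
        (Nat.mul_le_mul_left _ (Nat.le_add_left _ _)).trans (Nat.div_mul_le_self _ c.phaseLen)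
      calc _ ≤ ((T / c.phaseLen : ℕ) : ℝ) * c.τ := by gcongr
        _ ≤ T := by exact_mod_cast h2
    calc M * ((T / c.phaseLen : ℕ) * (c.commLen : ℝ))
        ≤ M * (T / τ₀ * (4 * C * (M * Real.log K * X))) := by gcongr
      _ = 4 * C * ((M ^ 2 * Real.log K * (T * X)) / τ₀) := by ring
      _ = 4 * C * B := by rw [← hcomm, mul_div_cancel_right₀ _ hτ₀.ne']
  -- The square of a minimum is at most the product of its two arguments, and `M² T τ₀` is `B²` up
  -- to the factor `K log K ≥ 1`.
  have hminτ : M * min (T : ℝ) c.τ ≤ 2 * B := by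
    refine le_of_sq_le_sq ?_ (by positivity)
    have h1 : min (T : ℝ) c.τ ^ 2 ≤ T * (2 * τ₀) := by
      rw [sq]
      exact mul_le_mul (min_le_left _ _) ((min_le_right _ _).trans hτ') (by positivity) hT'.le
    calc (M * min (T : ℝ) c.τ) ^ 2 = M ^ 2 * min (T : ℝ) c.τ ^ 2 := by ring
      _ ≤ M ^ 2 * (T * (2 * τ₀)) := by gcongr
      _ = 2 * (M ^ 2 * T * τ₀) * 1 := by ring
      _ ≤ 4 * (M ^ 2 * T * τ₀) * (K * Real.log K) := by gcongr; norm_num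
      _ = (2 * B) ^ 2 := by
        rw [mul_pow, hexpl]
        ring
  -- Here the cube is split as `T² * commLen`, matching the value of `B ^ 3` obtained by eliminating
  -- `τ₀` from `hcomm` and `hexpl`.
  have hmincomm : M * min (T : ℝ) c.commLen ≤ (4 * C + 1) * B := by
    refine le_of_pow_le_pow_left₀ (n := 3) (by norm_num) (by positivity) ?_
    have hB3 : B ^ 3 = M ^ 4 * K * Real.log K ^ 2 * T ^ 2 * X := by
      calc B ^ 3 = (M ^ 2 * K * Real.log K * T) * (B * τ₀) := by
            rw [pow_succ, hexpl]
            ring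
        _ = _ := by
            rw [hcomm]
            ring
    have h1 : min (T : ℝ) c.commLen ^ 3 ≤ T ^ 2 * (4 * C * (M * Real.log K * X)) := by
      rw [pow_succ]
      gcongr
      · exact min_le_left _ _
      · exact (min_le_right _ _).trans hcommLen
    have h2 : 4 * C ≤ (4 * C + 1) ^ 3 := by
      nlinarith [mul_nonneg hC hC, mul_nonneg hC (mul_nonneg hC hC)]
    calc (M * min (T : ℝ) c.commLen) ^ 3 = M ^ 3 * min (T : ℝ) c.commLen ^ 3 := by ring
      _ ≤ M ^ 3 * (T ^ 2 * (4 * C * (M * Real.log K * X))) := by gcongr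
      _ = 4 * C * (M ^ 4 * Real.log K * T ^ 2 * X) * 1 := by ring
      _ ≤ (4 * C + 1) ^ 3 * (M ^ 4 * Real.log K * T ^ 2 * X) * (K * Real.log K) := by gcongr
      _ = ((4 * C + 1) * B) ^ 3 := by
        rw [mul_pow, hB3]
        ring
  have hmin : M * min (T : ℝ) c.phaseLen ≤ (4 * C + 1) * B + 2 * B := by
    have h1 : min (T : ℝ) c.phaseLen ≤ min (T : ℝ) c.commLen + min (T : ℝ) c.τ := by
      unfold phaseLen
      push_cast
      exact min_add_le hT'.le (Nat.cast_nonneg _) (Nat.cast_nonneg _)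
    have h2 := mul_le_mul_of_nonneg_left h1 hM'.le
    linarith
  have hsqrt : Real.sqrt (Real.log (K.choose M) * c.τ * (M * K * T)) ≤ 2 * B := by
    refine Real.sqrt_le_iff.2 ⟨by positivity, ?_⟩
    calc Real.log (K.choose M) * c.τ * (M * K * T)
        ≤ (M * Real.log K) * (2 * τ₀) * (M * K * T) := by
          gcongr
          exact log_choose_le hMK
      _ = 2 * B ^ 2 := by
        rw [hexpl]
        ring
      _ ≤ (2 * B) ^ 2 := by nlinarith [sq_nonneg B]
  have := c.expectedRegret_le_sqrt hl hW (by exact_mod_cast hτpos) hT hη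
  linarith

/-- The bounds on the repetition length that hold for all large horizons. -/
theorem exists_bounds_of_isTheta {α ε : ℝ} (hε : 0 < ε) {h : ℕ → ℕ}
    (hh : (fun T : ℕ => (h T : ℝ)) =Θ[Filter.atTop] (fun T : ℕ => (T : ℝ) ^ (α + ε))) (w : ℝ) :
    ∃ C : ℝ, 0 ≤ C ∧ ∃ T₀ : ℕ, ∀ T ≥ T₀,
      (h T : ℝ) ≤ C * (T : ℝ) ^ (α + ε) ∧ w * (T : ℝ) ^ α < h T := by
  obtain ⟨C, hC, hup⟩ := hh.1.exists_nonneg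
  obtain ⟨D, hD, hlow⟩ := hh.2.exists_pos
  -- The extra exponent `ε` absorbs both `w` and the lower constant `1 / D` of `h`.
  have hlarge : ∀ᶠ T : ℕ in Filter.atTop, D * w < (T : ℝ) ^ ε :=
    ((tendsto_rpow_atTop hε).comp tendsto_natCast_atTop_atTop).eventually_gt_atTop _
  obtain ⟨T₀, hT₀⟩ := Filter.eventually_atTop.1
    ((hup.bound.and hlow.bound).and (hlarge.and (Filter.eventually_gt_atTop 0)))
  refine ⟨C, hC, T₀, fun T hT => ?_⟩
  obtain ⟨⟨h1, h2⟩, h3, h4⟩ := hT₀ T hT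
  have hTpos : (0 : ℝ) < T := by exact_mod_cast h4
  simp only [Real.norm_eq_abs, Nat.abs_cast, abs_of_nonneg (Real.rpow_nonneg hTpos.le _)] at h1 h2
  refine ⟨h1, ?_⟩
  have hα : 0 < (T : ℝ) ^ α := Real.rpow_pos_of_pos hTpos _
  have h5 : D * (w * (T : ℝ) ^ α) < D * h T := by
    calc D * (w * (T : ℝ) ^ α) = (T : ℝ) ^ α * (D * w) := by ring
      _ < (T : ℝ) ^ α * (T : ℝ) ^ ε := by gcongr
      _ = (T : ℝ) ^ (α + ε) := (Real.rpow_add hTpos _ _).symm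
      _ ≤ D * h T := h2
  exact lt_of_mul_lt_mul_left h5 hD.le

end A2C2

/-! ### Proof of the theorem. -/

theorem theorem1 (α ε : ℝ) (hα₀ : 0 ≤ α) (hα₁ : α ≤ 1) (hε : 0 < ε)
    (h : ℕ → ℕ)
    (hh : (fun T : ℕ => (h T : ℝ)) =Θ[Filter.atTop] (fun T : ℕ => (T : ℝ) ^ (α + ε)))
    (w : ℝ) :
    ∃ C : ℝ, 0 < C ∧
      ∀ (M K : ℕ) (hM : 1 < M) (hMK : M ≤ K) (T : ℕ), 1 ≤ T →
        ∀ l : ℕ → Fin K → ℝ, (∀ t < T, ∀ k, l t k ∈ Set.Icc (0 : ℝ) 1) →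
          (A2C2.localAttackability l T : ℝ) ≤ w * (T : ℝ) ^ α →
          ∀ τ : ℕ,
            τ = ⌈(M : ℝ) ^ (2 / 3 : ℝ) * (K : ℝ) ^ (-(1 / 3) : ℝ) *
              (Real.log K) ^ (1 / 3 : ℝ) * (T : ℝ) ^ ((1 + 2 * α + 2 * ε) / 3)⌉₊ →
            ∀ η : ℝ,
              η = Real.sqrt (Real.log (Nat.choose K M) * τ / (M * K * T)) →
              (A2C2.Config.mk (M := M) (K := K) hM hMK (h T) τ η).expectedRegret l T ≤
                C * ((M : ℝ) ^ (4 / 3 : ℝ) * (K : ℝ) ^ (1 / 3 : ℝ) *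
                  (Real.log K) ^ (2 / 3 : ℝ) * (T : ℝ) ^ ((2 + α + ε) / 3)) := by
  obtain ⟨C, hC, T₀, hT₀⟩ := A2C2.exists_bounds_of_isTheta hε hh w
  -- The part `8 * C + 6` collects `4 * C` for communication, `4 * C + 3` for the incomplete phase
  -- and `3` for exploration; `T₀` pays for the horizons below `T₀`.
  refine ⟨8 * C + 6 + T₀, by positivity, ?_⟩
  intro M K hM hMK T hT l hl hW τ hτ η hη
  set c : A2C2.Config M K := ⟨hM, hMK, h T, τ, η⟩ with hc
  have hK2 : 2 ≤ K := by omega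
  have hT1 : (1 : ℝ) ≤ T := by exact_mod_cast hT
  have hTpos : (0 : ℝ) < T := by positivity
  have hM2 : (2 : ℝ) ≤ M := by exact_mod_cast hM
  have hMpos : (0 : ℝ) < M := by positivity
  have hKpos : (0 : ℝ) < K := by positivity
  have hloghalf := A2C2.half_le_log_two.trans (A2C2.log_two_le_log_natCast hK2)
  have hlog : 0 < Real.log K := by linarith
  have hKlog := A2C2.one_le_mul_log hK2
  have hX : 1 ≤ (T : ℝ) ^ (α + ε) := Real.one_le_rpow hT1 (by positivity)
  set τ₀ : ℝ := (M : ℝ) ^ (2 / 3 : ℝ) * (K : ℝ) ^ (-(1 / 3) : ℝ) *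
    (Real.log K) ^ (1 / 3 : ℝ) * (T : ℝ) ^ ((1 + 2 * α + 2 * ε) / 3) with hτ₀
  set B : ℝ := (M : ℝ) ^ (4 / 3 : ℝ) * (K : ℝ) ^ (1 / 3 : ℝ) *
    (Real.log K) ^ (2 / 3 : ℝ) * (T : ℝ) ^ ((2 + α + ε) / 3) with hB
  have hτ₀pos : 0 < τ₀ := by positivity
  have hBpos : 0 < B := by positivity
  have hcomm : B * τ₀ = M ^ 2 * Real.log K * (T * (T : ℝ) ^ (α + ε)) := by
    calc B * τ₀ = ((M : ℝ) ^ (4 / 3 : ℝ) * (M : ℝ) ^ (2 / 3 : ℝ)) *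
          ((K : ℝ) ^ (1 / 3 : ℝ) * (K : ℝ) ^ (-(1 / 3) : ℝ)) *
          ((Real.log K) ^ (2 / 3 : ℝ) * (Real.log K) ^ (1 / 3 : ℝ)) *
          ((T : ℝ) ^ ((2 + α + ε) / 3) * (T : ℝ) ^ ((1 + 2 * α + 2 * ε) / 3)) := by
          rw [hB, hτ₀]
          ring
      _ = (M : ℝ) ^ (2 : ℝ) * (K : ℝ) ^ (0 : ℝ) * (Real.log K) ^ (1 : ℝ) *
          (T : ℝ) ^ (1 + (α + ε)) := by
          rw [← Real.rpow_add hMpos, ← Real.rpow_add hKpos, ← Real.rpow_add hlog,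
            ← Real.rpow_add hTpos]
          ring_nf
      _ = _ := by
          rw [Real.rpow_add hTpos, Real.rpow_two, Real.rpow_zero, Real.rpow_one, Real.rpow_one]
          ring
  have hexpl : B ^ 2 = M ^ 2 * K * Real.log K * T * τ₀ := by
    calc B ^ 2 = ((M : ℝ) ^ (4 / 3 : ℝ) * (M : ℝ) ^ (4 / 3 : ℝ)) *
          ((K : ℝ) ^ (1 / 3 : ℝ) * (K : ℝ) ^ (1 / 3 : ℝ)) *
          ((Real.log K) ^ (2 / 3 : ℝ) * (Real.log K) ^ (2 / 3 : ℝ)) *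
          ((T : ℝ) ^ ((2 + α + ε) / 3) * (T : ℝ) ^ ((2 + α + ε) / 3)) := by
          rw [hB]
          ring
      _ = ((M : ℝ) ^ (2 : ℝ) * (M : ℝ) ^ (2 / 3 : ℝ)) *
          ((K : ℝ) ^ (1 : ℝ) * (K : ℝ) ^ (-(1 / 3) : ℝ)) *
          ((Real.log K) ^ (1 : ℝ) * (Real.log K) ^ (1 / 3 : ℝ)) *
          ((T : ℝ) ^ (1 : ℝ) * (T : ℝ) ^ ((1 + 2 * α + 2 * ε) / 3)) := by
          simp only [← Real.rpow_add hMpos, ← Real.rpow_add hKpos, ← Real.rpow_add hlog,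
            ← Real.rpow_add hTpos]
          ring_nf
      _ = _ := by
          rw [Real.rpow_two, Real.rpow_one, Real.rpow_one, Real.rpow_one, hτ₀]
          ring
  -- This lets the trivial bound `M * T` be absorbed as `T₀ * B` when `T < T₀`.
  have hMB : M ≤ B := by
    refine le_of_pow_le_pow_left₀ (n := 3) (by norm_num) hBpos.le ?_
    have hB3 : B ^ 3 = M ^ 3 * (M * Real.log K) * (K * Real.log K) *
        (T ^ 2 * (T : ℝ) ^ (α + ε)) := by
      calc B ^ 3 = (M ^ 2 * K * Real.log K * T) * (B * τ₀) := by
            rw [pow_succ, hexpl]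
            ring
        _ = _ := by
            rw [hcomm]
            ring
    have h1 : 1 ≤ M * Real.log K := by nlinarith
    have h2 : 1 ≤ (T : ℝ) ^ 2 * (T : ℝ) ^ (α + ε) :=
      one_le_mul_of_one_le_of_one_le (one_le_pow₀ hT1) hX
    calc (M : ℝ) ^ 3 = M ^ 3 * 1 * 1 * 1 := by ring
      _ ≤ _ := by
        rw [hB3]
        gcongr
  have htriv := c.expectedRegret_le_mul hl
  have hCB : 0 ≤ C * B := by positivity
  rcases lt_or_ge T T₀ with hlt | hge
  · have h1 : (M : ℝ) * T ≤ B * T₀ := by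
      have : (T : ℝ) ≤ T₀ := by exact_mod_cast hlt.le
      gcongr
    linarith
  have hT₀B : 0 ≤ T₀ * B := by positivity
  -- Below 1 the ceiling need not be at most `2 * τ₀`. But then `M * T ≤ B * τ₀ ≤ B`, so the trivial
  -- bound suffices.
  rcases lt_or_ge τ₀ 1 with hτlt | hτge
  · have h1 : (M : ℝ) * T ≤ B := by
      calc (M : ℝ) * T = M * T * 1 * 1 := by ring
        _ ≤ M * T * (M * Real.log K) * (T : ℝ) ^ (α + ε) := by
          gcongr
          nlinarith
        _ = B * τ₀ := by
          rw [hcomm]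
          ring
        _ ≤ B := mul_le_of_le_one_right hBpos.le hτlt.le
    linarith
  obtain ⟨hup, hlow⟩ := hT₀ T hge
  have hτle : (τ : ℝ) ≤ 2 * τ₀ := by
    have := Nat.ceil_lt_add_one hτ₀pos.le
    rw [← hτ] at this
    linarith
  have hτge' : τ₀ ≤ τ := by
    rw [hτ]
    exact Nat.le_ceil _
  have hmain := c.expectedRegret_le_rate hl (by exact_mod_cast hW.trans_lt hlow) hT hη hC
    (zero_le_one.trans hX) hup hBpos.le hτ₀pos hτge' hτle hcomm hexpl
  linarith
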